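/- **Setting.** There are $n$ agents and $n$ items, and every agent $a$ has a complete strict preference list over the items. Utilities are linear: an agent's $i$-th choice ($1\le i\le n$) gives it utility $1-\frac{i-1}{n}$. The welfare of a perfect matching is the sum of the agents' utilities, and $\mathrm{OPT}(P)$ is the maximum welfare of a perfect matching in the instance $P$. In Random Serial Dictatorship (RSD) the agents arrive in a uniformly random order and each takes its most preferred item among those still unallocated; $\mathrm{RSD}(P)$ is the expected welfare of the resulting matching. For a real number $k$, call an instance $k$-efficient if some perfect matching gives every agent one of its top $k$ choices. **Theorem 3.** 1. For every function $k:\mathbb N\to\mathbb R$ with $k(n)=o(n)$ there is a sequence $\varepsilon_n\to 0$ (depending only on $k$) such that for every $n$ and every $k(n)$-efficient instance $P$ with $n$ agents, $$\mathrm{RSD}(P)\ \ge\ \left(\tfrac23-\varepsilon_n\right)\mathrm{OPT}(P).$$ 2. There is a sequence $\varepsilon_n\to0$ such that for every $n$ there is an $n^{1/5}$-efficient instance $P$ with $n$ agents and $$\mathrm{RSD}(P)\ \le\ \left(\tfrac23+\varepsilon_n\right)\mathrm{OPT}(P).$$ -/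

import Mathlib

open Filter Topology Asymptotics

namespace OneSidedMatching

/-- An instance with `n` agents and `n` items, both labelled by `Fin n`: every agent `a` has a
complete strict preference list, given by the permutation `P a` which sends the position `k`
(counted from `0`, most preferred first) to the item in that position of the list of `a`. -/
abbrev Profile (n : ℕ) : Type := Fin n → Equiv.Perm (Fin n)

variable {n : ℕ}

/-- The position, counted from `0`, of the item `i` in the preference list of the agent `a`. -/
def rank (P : Profile n) (a i : Fin n) : Fin n := (P a).symm i

/-- Linear utilities: the item at `0`-based position `r` is worth `1 - r / n`, that is, the
`i`-th choice, counted from `1`, is worth `1 - (i - 1) / n = (n - i + 1) / n`. -/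
noncomputable def utility (P : Profile n) (a i : Fin n) : ℝ :=
  1 - ((rank P a i : ℕ) : ℝ) / (n : ℝ)

/-- The social welfare of an assignment of items to agents. -/
noncomputable def welfare (P : Profile n) (M : Fin n → Fin n) : ℝ :=
  ∑ a, utility P a (M a)

/-- The optimal social welfare, over all perfect matchings of agents and items. -/
noncomputable def optWelfare (P : Profile n) : ℝ :=
  Finset.univ.sup' Finset.univ_nonempty (fun M : Equiv.Perm (Fin n) => welfare P M)

/-- Some perfect matching gives every agent one of its top `k` choices. -/
def IsEfficient (P : Profile n) (k : ℝ) : Prop :=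
  ∃ M : Equiv.Perm (Fin n), ∀ a, ((rank P a (M a) : ℕ) : ℝ) + 1 ≤ k

/-- The item which the agent `a` likes best among the items in `S`. The value for empty `S` is
irrelevant: see `available_nonempty`. -/
def bestItem (P : Profile n) (a : Fin n) (S : Finset (Fin n)) : Fin n :=
  if h : S.Nonempty then P a ((S.image (rank P a)).min' (h.image _)) else a

/-- The items that are still available after the first `t` agents have picked, when the agents
arrive in the order `σ 0, σ 1, …` and each picks its best available item. -/
def available (P : Profile n) (σ : Equiv.Perm (Fin n)) : ℕ → Finset (Fin n)
  | 0 => Finset.univ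
  | t + 1 =>
    if h : t < n then
      (available P σ t).erase (bestItem P (σ ⟨t, h⟩) (available P σ t))
    else available P σ t

/-- The outcome of serial dictatorship with arrival order `σ`: the agent `a`, who arrives at the
`0`-based time `σ.symm a`, gets its best item among those available at that time. -/
def serialDictatorship (P : Profile n) (σ : Equiv.Perm (Fin n)) (a : Fin n) : Fin n :=
  bestItem P a (available P σ (σ.symm a))

/-- The expected social welfare of random serial dictatorship: the average of the welfare of
serial dictatorship over all `n!` arrival orders of the agents. -/
noncomputable def rsdWelfare (P : Profile n) : ℝ :=
  (∑ σ : Equiv.Perm (Fin n), welfare P (serialDictatorship P σ)) /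
    (Fintype.card (Equiv.Perm (Fin n)) : ℝ)

theorem bestItem_mem (P : Profile n) (a : Fin n) {S : Finset (Fin n)} (h : S.Nonempty) :
    bestItem P a S ∈ S := by
  obtain ⟨i, hi, hr⟩ := Finset.mem_image.1 ((S.image (rank P a)).min'_mem (h.image _))
  rw [bestItem, dif_pos h, ← hr]
  simpa [rank] using hi

theorem available_nonempty (P : Profile n) (σ : Equiv.Perm (Fin n)) {t : ℕ} (ht : t < n) :
    (available P σ t).Nonempty := by
  have key : ∀ s, n ≤ (available P σ s).card + s := by
    intro s
    induction s with
    | zero => simp [available]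
    | succ s ih =>
      rw [available]
      split_ifs with h
      · have := Finset.pred_card_le_card_erase (s := available P σ s)
          (a := bestItem P (σ ⟨s, h⟩) (available P σ s))
        omega
      · omega
  have := key t
  exact Finset.card_pos.1 (by omega)

end OneSidedMatching

namespace OneSidedMatching

variable {n : ℕ}

/-! With linear utilities, welfare is `n` minus the sum of the 0-based ranks divided by `n`, so both
parts say that the expected total rank is about `n ^ 2 / 3`, at most or at least, while the optimum
is about `n`.

Lower bound on welfare. The agent arriving at time `t` gets rank at most `t`, since only `t` items
are gone, and rank at most `k - 1` if its partner in the efficient matching is still free. By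
`card_taken_le` the partner is gone with probability at most `(t + 1) / n`: moving the agent
elsewhere in the order keeps the partner taken by time `t + 1`, and on average a random item is
taken by then with that probability. Summing `t * (t + 1) / n` gives `n ^ 2 / 3` (`totalRank_le`).

Tight instance. Both inequalities must be nearly equalities. In `columnProfile` each agent first
wants the items of its column up to its level, which makes the instance efficient, and then
everything else by level. A Chernoff bound (`card_perm_few_le`) shows that typically each time
window slightly longer than a level brings enough agents of every column to exhaust the next level.
So at time `t` about the first `t` items are gone; an agent has lost its own items with probability
about `t / n`, and then its rank is about `t` (`level_mul_le_rank_pick`). -/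

/-! ### Monotonicity of serial dictatorship -/

theorem rank_bestItem_le (P : Profile n) (a : Fin n) {S : Finset (Fin n)} {i : Fin n}
    (hi : i ∈ S) : rank P a (bestItem P a S) ≤ rank P a i := by
  have h : S.Nonempty := ⟨i, hi⟩
  rw [bestItem, dif_pos h]
  simpa [rank] using Finset.min'_le (S.image (rank P a)) _ (Finset.mem_image_of_mem _ hi)

theorem bestItem_eq_of_subset (P : Profile n) (a : Fin n) {S T : Finset (Fin n)} (hST : S ⊆ T)
    (hT : bestItem P a T ∈ S) : bestItem P a S = bestItem P a T := by
  have h1 := rank_bestItem_le P a hT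
  have h2 := rank_bestItem_le P a (hST (bestItem_mem P a ⟨_, hT⟩))
  exact (P a).symm.injective (le_antisymm h1 h2)

/-- If the favourite in `T` survives in `S`, it is the favourite there too and is removed from both
sets. This lets an inclusion between available sets persist as the same agent picks from each. -/
theorem erase_bestItem_mono (P : Profile n) (a : Fin n) {S T : Finset (Fin n)} (hST : S ⊆ T) :
    S.erase (bestItem P a S) ⊆ T.erase (bestItem P a T) := by
  intro i hi
  rw [Finset.mem_erase] at hi ⊢
  refine ⟨fun h => hi.1 ?_, hST hi.2⟩
  rw [bestItem_eq_of_subset P a hST (h ▸ hi.2), h]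

theorem available_succ (P : Profile n) (σ : Equiv.Perm (Fin n)) {t : ℕ} (h : t < n) :
    available P σ (t + 1) =
      (available P σ t).erase (bestItem P (σ ⟨t, h⟩) (available P σ t)) := by
  rw [available, dif_pos h]

theorem available_succ_subset (P : Profile n) (σ : Equiv.Perm (Fin n)) (t : ℕ) :
    available P σ (t + 1) ⊆ available P σ t := by
  rw [available]
  split_ifs
  · exact Finset.erase_subset _ _
  · exact subset_rfl

theorem available_antitone (P : Profile n) (σ : Equiv.Perm (Fin n)) :
    Antitone (available P σ) :=
  antitone_nat_of_succ_le fun t => available_succ_subset P σ t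

theorem card_available (P : Profile n) (σ : Equiv.Perm (Fin n)) {t : ℕ} (ht : t ≤ n) :
    (available P σ t).card + t = n := by
  induction t with
  | zero => simp [available]
  | succ t ih =>
    have := ih (by omega)
    rw [available_succ P σ (by omega), Finset.card_erase_of_mem
      (bestItem_mem P _ (available_nonempty P σ (by omega)))]
    omega

theorem card_compl_available (P : Profile n) (σ : Equiv.Perm (Fin n)) {t : ℕ} (ht : t ≤ n) :
    (available P σ t)ᶜ.card = t := by
  have := card_available P σ ht
  rw [Finset.card_compl, Fintype.card_fin]
  omega

theorem available_congr (P : Profile n) {σ τ : Equiv.Perm (Fin n)} {t : ℕ}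
    (h : ∀ x : Fin n, (x : ℕ) < t → σ x = τ x) : available P σ t = available P τ t := by
  induction t with
  | zero => rfl
  | succ t ih =>
    have ih := ih fun x hx => h x (by omega)
    simp only [available, ih]
    split_ifs with ht
    · rw [h ⟨t, ht⟩ (by simp)]
    · rfl

/-- Letting an additional agent arrive at time `s`, and delaying the later agents, leaves fewer
items to those who come afterwards. -/
theorem available_insert_subset (P : Profile n) {σ τ : Equiv.Perm (Fin n)} {s : ℕ}
    (hlt : ∀ x : Fin n, (x : ℕ) < s → τ x = σ x) {t : ℕ} (hst : s ≤ t)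
    (hge : ∀ x (hx : x + 1 < n), s ≤ x → x < t → τ ⟨x + 1, hx⟩ = σ ⟨x, by omega⟩)
    (htn : t < n) : available P τ (t + 1) ⊆ available P σ t := by
  induction t, hst using Nat.le_induction with
  | base => exact (available_succ_subset P τ s).trans (available_congr P hlt).subset
  | succ t hst ih =>
    rw [available_succ P τ htn, available_succ P σ (t := t) (by omega),
      hge t htn hst (by omega)]
    exact erase_bestItem_mono P _ (ih (fun x hx h1 h2 => hge x hx h1 (by omega)) (by omega))

/-! ### Picks, ranks and welfare -/

/-- The item taken at time `t`. -/
def pick (P : Profile n) (σ : Equiv.Perm (Fin n)) (t : Fin n) : Fin n :=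
  bestItem P (σ t) (available P σ t)

theorem pick_mem (P : Profile n) (σ : Equiv.Perm (Fin n)) (t : Fin n) :
    pick P σ t ∈ available P σ t :=
  bestItem_mem P _ (available_nonempty P σ t.2)

theorem pick_notMem (P : Profile n) (σ : Equiv.Perm (Fin n)) {t : Fin n} {u : ℕ}
    (h : (t : ℕ) < u) : pick P σ t ∉ available P σ u := by
  intro hu
  have := available_antitone P σ (Nat.succ_le_of_lt h) hu
  rw [Nat.succ_eq_add_one, available_succ P σ t.2] at this
  exact (Finset.mem_erase.1 this).1 rfl

theorem pick_injective (P : Profile n) (σ : Equiv.Perm (Fin n)) :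
    Function.Injective (pick P σ) := by
  intro t u h
  rcases lt_trichotomy t u with h1 | h1 | h1
  · exact absurd (h ▸ pick_mem P σ u) (pick_notMem P σ h1)
  · exact h1
  · exact absurd (h ▸ pick_mem P σ t) (pick_notMem P σ h1)

theorem card_Iio_rank_image (P : Profile n) (a i : Fin n) :
    (Finset.univ.filter fun j => rank P a j < rank P a i).card = rank P a i := by
  rw [← Fin.card_Iio (rank P a i)]
  refine Finset.card_bij (fun j _ => rank P a j) (by simp) (fun _ _ _ _ h =>
    (P a).symm.injective h) fun b hb => ⟨P a b, ?_, ?_⟩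
  · exact Finset.mem_filter.2 ⟨Finset.mem_univ _, by simpa [rank] using hb⟩
  · simp [rank]

/-- Every item preferred to the pick must already be gone, and exactly `t` items are. -/
theorem rank_pick_le (P : Profile n) (σ : Equiv.Perm (Fin n)) (t : Fin n) :
    (rank P (σ t) (pick P σ t) : ℕ) ≤ t := by
  rw [← card_Iio_rank_image, ← card_compl_available P σ t.2.le]
  refine Finset.card_le_card fun j hj => ?_
  rw [Finset.mem_compl]
  intro hj'
  exact absurd (rank_bestItem_le P (σ t) hj') (not_le.2 (Finset.mem_filter.1 hj).2)

/-- The sum over all arrival orders and all agents of the position of the received item. -/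
def totalRank (P : Profile n) : ℕ :=
  ∑ t : Fin n, ∑ σ : Equiv.Perm (Fin n), (rank P (σ t) (pick P σ t) : ℕ)

theorem welfare_serialDictatorship (P : Profile n) (σ : Equiv.Perm (Fin n)) :
    welfare P (serialDictatorship P σ) =
      n - (∑ t : Fin n, ((rank P (σ t) (pick P σ t) : ℕ) : ℝ)) / n := by
  rw [welfare, ← Equiv.sum_comp σ]
  simp [utility, serialDictatorship, pick, Finset.sum_div]

theorem rsdWelfare_eq (P : Profile n) :
    rsdWelfare P = n - (totalRank P : ℝ) / (n * n.factorial) := by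
  have h : (n.factorial : ℝ) ≠ 0 := by positivity
  rw [rsdWelfare, Fintype.card_perm, Fintype.card_fin]
  simp_rw [welfare_serialDictatorship]
  rw [Finset.sum_sub_distrib, ← Finset.sum_div, Finset.sum_comm, sub_div]
  congr 1
  · simp [Fintype.card_perm]
    field_simp
  · rw [totalRank, div_div]
    push_cast
    rfl

theorem utility_nonneg (P : Profile n) (a i : Fin n) : 0 ≤ utility P a i := by
  have : ((rank P a i : ℕ) : ℝ) ≤ n := by exact_mod_cast (rank P a i).2.le
  exact sub_nonneg.2 (div_le_one_of_le₀ this (by positivity))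

theorem utility_pos (P : Profile n) (a i : Fin n) : 0 < utility P a i := by
  have : ((rank P a i : ℕ) : ℝ) < n := by exact_mod_cast (rank P a i).2
  exact sub_pos.2 ((div_lt_one (lt_of_le_of_lt (by positivity) this)).2 this)

theorem utility_le_one (P : Profile n) (a i : Fin n) : utility P a i ≤ 1 := by
  unfold utility
  have : 0 ≤ ((rank P a i : ℕ) : ℝ) / n := by positivity
  linarith

theorem rsdWelfare_nonneg (P : Profile n) : 0 ≤ rsdWelfare P :=
  div_nonneg (Finset.sum_nonneg fun _ _ => Finset.sum_nonneg fun _ _ => utility_nonneg _ _ _)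
    (by positivity)

theorem welfare_le_optWelfare (P : Profile n) (M : Equiv.Perm (Fin n)) :
    welfare P M ≤ optWelfare P :=
  Finset.le_sup' (fun M : Equiv.Perm (Fin n) => welfare P M) (Finset.mem_univ M)

theorem optWelfare_nonneg (P : Profile n) : 0 ≤ optWelfare P :=
  (Finset.sum_nonneg fun _ _ => utility_nonneg _ _ _).trans
    (welfare_le_optWelfare P (Equiv.refl _))

theorem optWelfare_le (P : Profile n) : optWelfare P ≤ n := by
  refine Finset.sup'_le _ _ fun M _ => ?_
  refine (Finset.sum_le_sum fun a _ => utility_le_one P a (M a)).trans ?_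
  simp

theorem optWelfare_pos (P : Profile n) (hn : 0 < n) : 0 < optWelfare P :=
  (Finset.sum_pos (fun _ _ => utility_pos _ _ _) ⟨⟨0, hn⟩, Finset.mem_univ _⟩).trans_le
    (welfare_le_optWelfare P (Equiv.refl _))

/-! ### Lower bound on the welfare of random serial dictatorship -/

/-- An agent who occupies a fixed position of a random arrival order is uniformly distributed. -/
theorem card_mul_sum_perm_apply (f : Fin n → ℕ) (t : Fin n) :
    n * ∑ σ : Equiv.Perm (Fin n), f (σ t) = n.factorial * ∑ a, f a := by
  have h : ∀ s : Fin n, ∑ σ : Equiv.Perm (Fin n), f (σ s) =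
      ∑ σ : Equiv.Perm (Fin n), f (σ t) := fun s => by
    rw [← Equiv.sum_comp (Equiv.mulRight (Equiv.swap s t))]
    simp
  calc n * ∑ σ : Equiv.Perm (Fin n), f (σ t)
      = ∑ s : Fin n, ∑ σ : Equiv.Perm (Fin n), f (σ s) := by simp [h]
    _ = ∑ σ : Equiv.Perm (Fin n), ∑ a, f a := by
        rw [Finset.sum_comm]
        exact Finset.sum_congr rfl fun σ _ => Equiv.sum_comp σ f
    _ = _ := by simp [Fintype.card_perm]

/-- The agent at time `t` is moved to time `s`. Moving it forward delays the agents in between by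
one step, a cycle; moving it back is a swap that leaves the first `t` arrivals untouched. Either
way, all items gone at time `t` are gone one step later in the new order. -/
theorem exists_perm_move (P : Profile n) (s t : Fin n) : ∃ c : Equiv.Perm (Fin n), c s = t ∧
    ∀ σ : Equiv.Perm (Fin n), available P (σ * c) (t + 1) ⊆ available P σ t := by
  have : NeZero n := ⟨(Fin.pos s).ne'⟩
  rcases le_or_gt s t with hst | hst
  · refine ⟨(Fin.cycleIcc s t)⁻¹, ?_, fun σ => ?_⟩
    · rw [Equiv.Perm.inv_eq_iff_eq, Fin.cycleIcc_of_last hst]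
    · refine available_insert_subset P (s := s) (fun x hx => ?_) hst (fun x hx h1 h2 => ?_) t.2
      · rw [Equiv.Perm.mul_apply]
        congr 1
        rw [Equiv.Perm.inv_eq_iff_eq, Fin.cycleIcc_of_lt hx]
      · rw [Equiv.Perm.mul_apply]
        congr 1
        rw [Equiv.Perm.inv_eq_iff_eq, Fin.cycleIcc_of_ge_of_lt h1 h2]
        ext
        rw [Fin.val_add_one_of_lt']
        exact hx
  · refine ⟨Equiv.swap s t, by simp, fun σ => (available_succ_subset _ _ _).trans
      (available_congr P fun x hx => ?_).subset⟩
    rw [Equiv.Perm.mul_apply, Equiv.swap_apply_of_ne_of_ne]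
    · exact ne_of_lt (lt_trans hx hst)
    · exact ne_of_lt hx

theorem card_taken_at_le (P : Profile n) (a i s t : Fin n) :
    (Finset.univ.filter fun σ : Equiv.Perm (Fin n) => σ t = a ∧ i ∉ available P σ t).card ≤
    (Finset.univ.filter fun σ : Equiv.Perm (Fin n) =>
      σ s = a ∧ i ∉ available P σ (t + 1)).card := by
  obtain ⟨c, hc, h⟩ := exists_perm_move P s t
  refine Finset.card_le_card_of_injOn (fun σ => σ * c) (fun σ hσ => ?_)
    fun _ _ _ _ h => mul_right_cancel h
  simp only [Finset.coe_filter, Finset.mem_univ, true_and, Set.mem_ofPred_eq] at hσ ⊢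
  exact ⟨by simp [hc, hσ.1], fun h' => hσ.2 (h σ h')⟩

/-- The agent who arrives at time `t` finds its partner under `M` taken with probability at most
`(t + 1) / n`. -/
theorem card_taken_le (P : Profile n) (M : Equiv.Perm (Fin n)) (t : Fin n) :
    n * (Finset.univ.filter fun σ : Equiv.Perm (Fin n) =>
      M (σ t) ∉ available P σ t).card ≤ (t + 1) * n.factorial := by
  classical
  have h1 : (Finset.univ.filter fun σ : Equiv.Perm (Fin n) => M (σ t) ∉ available P σ t).card =
      ∑ a, (Finset.univ.filter fun σ : Equiv.Perm (Fin n) =>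
        σ t = a ∧ M a ∉ available P σ t).card := by
    rw [Finset.card_eq_sum_card_fiberwise (f := fun σ : Equiv.Perm (Fin n) => σ t)
      (t := Finset.univ) (by simp)]
    refine Finset.sum_congr rfl fun a _ => ?_
    congr 1
    ext σ
    simp only [Finset.mem_filter, Finset.mem_univ, true_and]
    constructor
    · rintro ⟨h, rfl⟩; exact ⟨rfl, h⟩
    · rintro ⟨rfl, h⟩; exact ⟨h, rfl⟩
  -- The bound of `card_taken_at_le` holds for each of the `n` target times `s`; summing over `s`
  -- removes the condition on where `a` arrives.
  have h2 : ∀ a, n * (Finset.univ.filter fun σ : Equiv.Perm (Fin n) =>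
        σ t = a ∧ M a ∉ available P σ t).card ≤
      (Finset.univ.filter fun σ : Equiv.Perm (Fin n) => M a ∉ available P σ (t + 1)).card := by
    intro a
    rw [Finset.card_eq_sum_card_fiberwise (f := fun σ : Equiv.Perm (Fin n) => σ.symm a)
      (t := Finset.univ) (s := Finset.univ.filter fun σ : Equiv.Perm (Fin n) =>
        M a ∉ available P σ (t + 1)) (by simp)]
    calc _ = ∑ s : Fin n, (Finset.univ.filter fun σ : Equiv.Perm (Fin n) =>
        σ t = a ∧ M a ∉ available P σ t).card := by simp
      _ ≤ _ := Finset.sum_le_sum fun s _ => (card_taken_at_le P a (M a) s t).trans ?_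
    refine Finset.card_le_card fun σ hσ => ?_
    simp only [Finset.mem_filter, Finset.mem_univ, true_and] at hσ ⊢
    exact ⟨hσ.2, by rw [Equiv.symm_apply_eq, hσ.1]⟩
  calc _ = ∑ a, n * (Finset.univ.filter fun σ : Equiv.Perm (Fin n) =>
        σ t = a ∧ M a ∉ available P σ t).card := by rw [h1, Finset.mul_sum]
    _ ≤ ∑ a, (Finset.univ.filter fun σ : Equiv.Perm (Fin n) =>
        M a ∉ available P σ (t + 1)).card := Finset.sum_le_sum fun a _ => h2 a
    _ = ∑ σ : Equiv.Perm (Fin n), ∑ a, if M a ∉ available P σ (t + 1) then 1 else 0 := by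
        rw [Finset.sum_comm]
        simp_rw [Finset.card_filter]
    -- `M` is a bijection, so the sum counts all items gone after `t + 1` arrivals.
    _ = ∑ σ : Equiv.Perm (Fin n), ((t : ℕ) + 1) := by
        refine Finset.sum_congr rfl fun σ _ => ?_
        rw [Equiv.sum_comp M fun i => if i ∉ available P σ (t + 1) then 1 else 0,
          ← Finset.card_filter]
        refine Eq.trans ?_ (card_compl_available P σ (t := t + 1) t.2)
        congr 1
        ext
        simp
    _ = _ := by simp [Fintype.card_perm, mul_comm]

theorem sum_fin_mul_succ (n : ℕ) :
    ∑ t : Fin n, ((t : ℕ) : ℝ) * ((t : ℕ) + 1) = (n - 1) * n * (n + 1) / 3 := by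
  rw [Fin.sum_univ_eq_sum_range (fun t : ℕ => (t : ℝ) * (t + 1))]
  induction n with
  | zero => simp
  | succ n ih =>
    rw [Finset.sum_range_succ, ih]
    push_cast
    ring

theorem totalRank_le (P : Profile n) {k : ℝ} (hk : IsEfficient P k) (hn : 0 < n) :
    (totalRank P : ℝ) ≤ n * n.factorial * (k - 1 + n / 3) := by
  obtain ⟨M, hM⟩ := hk
  have hk1 : 0 ≤ k - 1 := by
    have := hM ⟨0, hn⟩
    have h0 : (0 : ℝ) ≤ ((rank P ⟨0, hn⟩ (M ⟨0, hn⟩) : ℕ) : ℝ) := by positivity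
    linarith
  have hn' : (0 : ℝ) < n := by exact_mod_cast hn
  have h1 : ∀ (t : Fin n) (σ : Equiv.Perm (Fin n)), ((rank P (σ t) (pick P σ t) : ℕ) : ℝ) ≤
      (k - 1) + (t : ℕ) * (if M (σ t) ∉ available P σ t then (1 : ℝ) else 0) := by
    intro t σ
    by_cases h : M (σ t) ∉ available P σ t
    · rw [if_pos h]
      have : ((rank P (σ t) (pick P σ t) : ℕ) : ℝ) ≤ (t : ℕ) := by
        exact_mod_cast rank_pick_le P σ t
      linarith
    · rw [if_neg h]
      have h2 : ((rank P (σ t) (pick P σ t) : ℕ) : ℝ) ≤ (rank P (σ t) (M (σ t)) : ℕ) := by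
        exact_mod_cast rank_bestItem_le P (σ t) (not_not.1 h)
      have := hM (σ t)
      linarith
  have h2 : ∀ t : Fin n, ∑ σ : Equiv.Perm (Fin n), ((rank P (σ t) (pick P σ t) : ℕ) : ℝ) ≤
      n.factorial * (k - 1) + (t : ℕ) * (((t : ℕ) + 1) * n.factorial / n) := by
    intro t
    refine (Finset.sum_le_sum fun σ _ => h1 t σ).trans ?_
    rw [Finset.sum_add_distrib, ← Finset.mul_sum, ← Finset.natCast_card_filter]
    have h3 : ((n * (Finset.univ.filter fun σ : Equiv.Perm (Fin n) =>
      M (σ t) ∉ available P σ t).card : ℕ) : ℝ) ≤ (((t + 1) * n.factorial : ℕ) : ℝ) :=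
      Nat.cast_le.2 (card_taken_le P M t)
    push_cast at h3
    refine add_le_add (by simp [Fintype.card_perm, mul_sub]) (mul_le_mul_of_nonneg_left ?_ (by positivity))
    rw [le_div_iff₀ hn']
    linarith
  calc (totalRank P : ℝ)
      = ∑ t : Fin n, ∑ σ : Equiv.Perm (Fin n), ((rank P (σ t) (pick P σ t) : ℕ) : ℝ) := by
        rw [totalRank]; push_cast; rfl
    _ ≤ _ := Finset.sum_le_sum fun t _ => h2 t
    _ = n * n.factorial * (k - 1) + n.factorial / n *
        ∑ t : Fin n, ((t : ℕ) : ℝ) * ((t : ℕ) + 1) := by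
        rw [Finset.sum_add_distrib, Finset.mul_sum]
        congr 1
        · simp; ring
        · exact Finset.sum_congr rfl fun t _ => by ring
    _ = n * n.factorial * (k - 1) + n.factorial * ((n ^ 2 - 1) / 3) := by
        rw [sum_fin_mul_succ]
        field_simp
        ring
    _ ≤ _ := by
        have : (0 : ℝ) ≤ n.factorial := by positivity
        nlinarith

theorem le_rsdWelfare (P : Profile n) {k : ℝ} (hk : IsEfficient P k) (hn : 0 < n) :
    2 / 3 * n - (k - 1) ≤ rsdWelfare P := by
  have hn' : (0 : ℝ) < n := by exact_mod_cast hn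
  have h := totalRank_le P hk hn
  have h2 : (totalRank P : ℝ) / (n * n.factorial) ≤ k - 1 + n / 3 := by
    rw [div_le_iff₀ (by positivity)]
    linarith
  rw [rsdWelfare_eq]
  linarith

theorem mul_optWelfare_le_rsdWelfare (P : Profile n) {k : ℝ} (hk : IsEfficient P k) :
    (2 / 3 - |k| / n) * optWelfare P ≤ rsdWelfare P := by
  rcases Nat.eq_zero_or_pos n with rfl | hn
  · have : optWelfare P = 0 :=
      le_antisymm (by simpa using optWelfare_le P) (optWelfare_nonneg P)
    rw [this, mul_zero]
    exact rsdWelfare_nonneg P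
  have hn' : (0 : ℝ) < n := by exact_mod_cast hn
  -- If the factor is negative the claim is trivial; otherwise the optimum may be replaced by its
  -- upper bound `n`.
  rcases le_total 0 (2 / 3 - |k| / n) with h | h
  · refine (mul_le_mul_of_nonneg_left (optWelfare_le P) h).trans
      (le_trans ?_ (le_rsdWelfare P hk hn))
    rw [sub_mul, div_mul_cancel₀ _ hn'.ne']
    linarith [le_abs_self k]
  · exact (mul_nonpos_of_nonpos_of_nonneg h (optWelfare_nonneg P)).trans (rsdWelfare_nonneg P)

/-! ### Chernoff bound for random permutations -/

/-- The events that different elements are mapped into `U` by a random permutation are negatively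
correlated. -/
theorem card_perm_mapsTo_le (U S : Finset (Fin n)) :
    n ^ S.card * (Finset.univ.filter fun τ : Equiv.Perm (Fin n) => ∀ a ∈ S, τ a ∈ U).card ≤
      U.card ^ S.card * n.factorial := by
  classical
  induction S using Finset.induction_on with
  | empty => simp [Fintype.card_perm]
  | insert b S hb ih =>
    set N : Finset (Equiv.Perm (Fin n)) := Finset.univ.filter fun τ => ∀ a ∈ S, τ a ∈ U with hN
    have hins : ∀ c : Fin n, (Finset.univ.filter fun τ : Equiv.Perm (Fin n) =>
        ∀ a ∈ insert c S, τ a ∈ U) = N.filter fun τ => τ c ∈ U := by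
      intro c
      ext τ
      simp [hN, and_comm]
    -- Given that `S` is mapped into `U`, the new element `b` is the least likely to land there:
    -- elements of `S` do so surely, and all others are exchangeable with `b`. Hence its probability
    -- is at most the average `U.card / n`.
    have hle : ∀ c : Fin n, (N.filter fun τ => τ b ∈ U).card ≤
        (N.filter fun τ => τ c ∈ U).card := by
      intro c
      by_cases hc : c ∈ S
      · refine Finset.card_le_card fun τ hτ => ?_
        simp only [Finset.mem_filter] at hτ ⊢
        refine ⟨hτ.1, ?_⟩
        have := hτ.1
        simp only [hN, Finset.mem_filter] at this
        exact this.2 c hc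
      · refine Finset.card_le_card_of_injOn (fun τ => τ * Equiv.swap b c) (fun τ hτ => ?_)
          fun _ _ _ _ h => mul_right_cancel h
        simp only [hN, Finset.coe_filter, Finset.mem_filter, Finset.mem_univ, true_and,
          Set.mem_ofPred_eq] at hτ ⊢
        refine ⟨fun a ha => ?_, by simpa using hτ.2⟩
        rw [Equiv.Perm.mul_apply, Equiv.swap_apply_of_ne_of_ne]
        · exact hτ.1 a ha
        · rintro rfl; exact hb ha
        · rintro rfl; exact hc ha
    have hsum : n * (N.filter fun τ => τ b ∈ U).card ≤ U.card * N.card := by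
      calc n * (N.filter fun τ => τ b ∈ U).card
          = ∑ c : Fin n, (N.filter fun τ => τ b ∈ U).card := by simp
        _ ≤ ∑ c : Fin n, (N.filter fun τ => τ c ∈ U).card := Finset.sum_le_sum fun c _ => hle c
        _ = ∑ τ ∈ N, ∑ c : Fin n, if τ c ∈ U then 1 else 0 := by
            rw [Finset.sum_comm]
            simp_rw [Finset.card_filter]
        _ = ∑ τ ∈ N, U.card := by
            refine Finset.sum_congr rfl fun τ _ => ?_
            rw [Equiv.sum_comp τ fun c => if c ∈ U then 1 else 0]
            simp
        _ = _ := by simp [mul_comm]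
    rw [hins, Finset.card_insert_of_notMem hb, pow_succ, pow_succ, mul_assoc]
    calc n ^ S.card * (n * (N.filter fun τ => τ b ∈ U).card)
        ≤ n ^ S.card * (U.card * N.card) := Nat.mul_le_mul_left _ hsum
      _ = U.card * (n ^ S.card * N.card) := by ring
      _ ≤ U.card * (U.card ^ S.card * n.factorial) := Nat.mul_le_mul_left _ ih
      _ = _ := by ring

/-- Expanding the product of `(1 - z) * [τ a ∉ W] + z` over `a ∈ A` gives nonnegative coefficients
times probabilities of mapping subsets into `Wᶜ`. Negative correlation bounds each of these by the
value for independent elements. -/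
theorem sum_perm_pow_card_le (hn : 0 < n) (W A : Finset (Fin n)) {z : ℝ} (hz0 : 0 ≤ z)
    (hz1 : z ≤ 1) :
    ∑ τ : Equiv.Perm (Fin n), z ^ (A.filter fun a => τ a ∈ W).card ≤
      n.factorial * (1 - (1 - z) * (W.card / n)) ^ A.card := by
  classical
  have hn' : (0 : ℝ) < n := by exact_mod_cast hn
  have hexp : ∀ τ : Equiv.Perm (Fin n), z ^ (A.filter fun a => τ a ∈ W).card =
      ∑ S ∈ A.powerset, (if ∀ a ∈ S, τ a ∈ Wᶜ then (1 : ℝ) else 0) *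
        ((1 - z) ^ S.card * z ^ (A.card - S.card)) := by
    intro τ
    have h1 : z ^ (A.filter fun a => τ a ∈ W).card =
        ∏ a ∈ A, ((1 - z) * (if τ a ∈ Wᶜ then 1 else 0) + z) := by
      rw [← Finset.prod_const, Finset.prod_filter]
      refine Finset.prod_congr rfl fun a _ => ?_
      by_cases h : τ a ∈ W <;> simp [h]
    rw [h1, Finset.prod_add]
    refine Finset.sum_congr rfl fun S hS => ?_
    rw [Finset.prod_mul_distrib, Finset.prod_const, Finset.prod_const, Finset.prod_boole,
      Finset.card_sdiff_of_subset (Finset.mem_powerset.1 hS), mul_comm ((1 - z) ^ S.card),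
      mul_assoc]
    congr
  have hU : (((Wᶜ : Finset (Fin n)).card : ℕ) : ℝ) = n - W.card := by
    rw [Finset.card_compl, Fintype.card_fin, Nat.cast_sub]
    simpa using Finset.card_le_univ W
  calc _ = ∑ S ∈ A.powerset, ((Finset.univ.filter fun τ : Equiv.Perm (Fin n) =>
        ∀ a ∈ S, τ a ∈ Wᶜ).card : ℝ) * ((1 - z) ^ S.card * z ^ (A.card - S.card)) := by
        simp_rw [hexp]
        rw [Finset.sum_comm]
        refine Finset.sum_congr rfl fun S _ => ?_
        rw [← Finset.sum_mul, Finset.natCast_card_filter]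
    _ ≤ ∑ S ∈ A.powerset, (n.factorial * ((n - W.card) / n : ℝ) ^ S.card) *
        ((1 - z) ^ S.card * z ^ (A.card - S.card)) := by
        refine Finset.sum_le_sum fun S _ => mul_le_mul_of_nonneg_right ?_
          (mul_nonneg (pow_nonneg (by linarith) _) (pow_nonneg hz0 _))
        have := card_perm_mapsTo_le (Wᶜ) S
        have h2 : ((n ^ S.card * (Finset.univ.filter fun τ : Equiv.Perm (Fin n) =>
            ∀ a ∈ S, τ a ∈ Wᶜ).card : ℕ) : ℝ) ≤
            (((Wᶜ : Finset (Fin n)).card ^ S.card * n.factorial : ℕ) : ℝ) := Nat.cast_le.2 this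
        push_cast [hU] at h2
        rw [div_pow, mul_div_assoc', le_div_iff₀ (by positivity)]
        linarith
    _ = n.factorial * ∑ S ∈ A.powerset, ((1 - z) * ((n - W.card) / n : ℝ)) ^ S.card *
        z ^ (A.card - S.card) := by
        rw [Finset.mul_sum]
        exact Finset.sum_congr rfl fun S _ => by rw [mul_pow]; ring
    _ = _ := by
        rw [Finset.sum_pow_mul_eq_add_pow]
        congr 2
        rw [sub_div, div_self hn'.ne']
        ring

/-- A Chernoff bound for the number of elements of `A` which a random permutation maps into
`W`. -/
theorem card_perm_few_le (hn : 0 < n) (W A : Finset (Fin n)) {d : ℕ} {η : ℝ} (hη : 0 < η)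
    (h : (1 + η) ^ 2 * d * n ≤ W.card * A.card) :
    ((Finset.univ.filter fun τ : Equiv.Perm (Fin n) =>
      (A.filter fun a => τ a ∈ W).card < d).card : ℝ) ≤
      n.factorial * Real.exp (-(η ^ 2 * d)) := by
  have hn' : (0 : ℝ) < n := by exact_mod_cast hn
  -- Markov's inequality is applied to `z` raised to the number of hits, which is at least `z ^ d`
  -- on the bad event.
  set z : ℝ := (1 + η)⁻¹ with hz
  have hz0 : 0 < z := by positivity
  have hz1 : z ≤ 1 := inv_le_one_of_one_le₀ (by linarith)
  set B := Finset.univ.filter fun τ : Equiv.Perm (Fin n) =>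
      (A.filter fun a => τ a ∈ W).card < d
  have h1 : (B.card : ℝ) * z ^ d ≤ n.factorial * (1 - (1 - z) * (W.card / n)) ^ A.card := by
    refine le_trans ?_ (sum_perm_pow_card_le hn W A hz0.le hz1)
    rw [← nsmul_eq_mul, ← Finset.sum_const]
    refine (Finset.sum_le_sum fun τ hτ => ?_).trans
      (Finset.sum_le_univ_sum_of_nonneg fun τ => by positivity)
    exact pow_le_pow_of_le_one hz0.le hz1 (Finset.mem_filter.1 hτ).2.le
  have hW : (W.card : ℝ) / n ≤ 1 := by
    rw [div_le_one hn']
    exact_mod_cast (by simpa using Finset.card_le_univ W)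
  have h2 : (1 - (1 - z) * ((W.card : ℝ) / n)) ^ A.card ≤ Real.exp (-(η * (1 + η) * d)) := by
    have h3 : 0 ≤ 1 - (1 - z) * ((W.card : ℝ) / n) := by
      have : 0 ≤ (W.card : ℝ) / n := by positivity
      nlinarith
    have h4 : 1 - (1 - z) * ((W.card : ℝ) / n) ≤ Real.exp (-((1 - z) * (W.card / n))) := by
      linarith [Real.add_one_le_exp (-((1 - z) * ((W.card : ℝ) / n)))]
    refine (pow_le_pow_left₀ h3 h4 _).trans ?_
    rw [← Real.exp_nat_mul]
    refine Real.exp_le_exp.2 ?_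
    have h5 : (1 - z) = η / (1 + η) := by rw [hz]; field_simp; ring
    have h6 : (1 + η) ^ 2 * d ≤ W.card / n * A.card := by
      rw [div_mul_eq_mul_div, le_div_iff₀ hn']
      exact h
    have h7 : η / (1 + η) * ((1 + η) ^ 2 * d) ≤ η / (1 + η) * (W.card / n * A.card) :=
      mul_le_mul_of_nonneg_left h6 (by positivity)
    have h8 : η / (1 + η) * ((1 + η) ^ 2 * d) = η * (1 + η) * d := by field_simp
    rw [h5]
    linarith
  have h9 : (1 + η) ^ d ≤ Real.exp (η * d) := by
    rw [mul_comm, Real.exp_nat_mul]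
    exact pow_le_pow_left₀ (by positivity) (by linarith [Real.add_one_le_exp η]) _
  calc (B.card : ℝ) = (B.card * z ^ d) * (1 + η) ^ d := by
        rw [mul_assoc, ← mul_pow, hz, inv_mul_cancel₀ (by positivity), one_pow, mul_one]
    _ ≤ (n.factorial * Real.exp (-(η * (1 + η) * d))) * Real.exp (η * d) := by
        refine mul_le_mul (h1.trans (mul_le_mul_of_nonneg_left h2 (by positivity))) h9
          (by positivity) (by positivity)
    _ = _ := by
        rw [mul_assoc, ← Real.exp_add]
        congr 2
        ring

/-! ### The column instance -/

/-- The key by which an agent orders the items in the instance `columnProfile`. Items and agents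
are arranged in `C` columns and in levels of `d * C` items. An agent prefers the items of its own
column up to its own level, and then goes through the levels, starting each of them with the items
of its own column. -/
def columnKey (C d : ℕ) (a i : Fin n) : ℕ :=
  if (i : ℕ) % C = a % C ∧ (i : ℕ) / (d * C) ≤ a / (d * C) then (i : ℕ) / (d * C)
  else n + 1 + 2 * ((i : ℕ) / (d * C)) + if (i : ℕ) % C = a % C then 0 else 1

/-- An instance in which each agent competes with its own column for the good items. -/
def columnProfile (n C d : ℕ) : Profile n := fun a => Tuple.sort (columnKey C d a)

theorem columnKey_le_of_rank_le {C d : ℕ} {a i j : Fin n}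
    (h : rank (columnProfile n C d) a i ≤ rank (columnProfile n C d) a j) :
    columnKey C d a i ≤ columnKey C d a j := by
  have := Tuple.monotone_sort (columnKey C d a) h
  simpa [rank, columnProfile] using this

/-- Ensures that the keys of an agent's own items stay below the offset `n + 1` of all others. -/
theorem level_le (C d : ℕ) (i : Fin n) : (i : ℕ) / (d * C) ≤ n :=
  (Nat.div_le_self _ _).trans i.2.le

theorem card_column (n : ℕ) {C : ℕ} (hC : 0 < C) (c : ℕ) :
    (Finset.univ.filter fun i : Fin n => (i : ℕ) % C = c % C).card =
      n / C + if c % C < n % C then 1 else 0 := by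
  rw [← Nat.count_modEq_card n hC c, Nat.count_eq_card_filter_range]
  refine Finset.card_bij (fun i _ => (i : ℕ)) ?_ ?_ ?_
  · intro i hi
    simp only [Finset.mem_filter, Finset.mem_univ, true_and] at hi
    exact Finset.mem_filter.2 ⟨Finset.mem_range.2 i.2, hi⟩
  · intro i _ j _ h
    exact Fin.ext h
  · intro b hb
    simp only [Finset.mem_filter, Finset.mem_range] at hb
    exact ⟨⟨b, hb.1⟩, by simpa [Nat.ModEq] using hb.2, rfl⟩

/-- The identity matching works: whatever agent `a` prefers to item `a` lies in its own column,
which has at most `s` items. -/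
theorem columnProfile_isEfficient {C d s : ℕ} (hC : 0 < C) (hs : n ≤ s * C) :
    IsEfficient (columnProfile n C d) (s : ℝ) := by
  refine ⟨Equiv.refl _, fun a => ?_⟩
  have hcol : (Finset.univ.filter fun i : Fin n => (i : ℕ) % C = (a : ℕ) % C).card ≤ s := by
    rw [card_column n hC]
    have := Nat.div_add_mod n C
    split_ifs with h
    · by_contra hlt
      have h2 : s ≤ n / C := by omega
      have h3 : C * s ≤ C * (n / C) := Nat.mul_le_mul_left _ h2
      have : s * C = C * s := mul_comm _ _
      omega
    · exact Nat.div_le_of_le_mul (by rwa [mul_comm])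
  have hsub : insert a (Finset.univ.filter fun j : Fin n =>
      rank (columnProfile n C d) a j < rank (columnProfile n C d) a a) ⊆
      Finset.univ.filter fun i : Fin n => (i : ℕ) % C = (a : ℕ) % C := by
    intro i hi
    rw [Finset.mem_insert] at hi
    rcases hi with rfl | hi
    · simp
    · have h1 := columnKey_le_of_rank_le (Finset.mem_filter.1 hi).2.le
      have h2 := level_le C d a
      simp only [columnKey, le_refl, and_self, if_true] at h1
      simp only [Finset.mem_filter, Finset.mem_univ, true_and]
      by_contra h3
      rw [if_neg (fun h => h3 h.1)] at h1
      omega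
  have := (Finset.card_le_card hsub).trans hcol
  rw [Finset.card_insert_of_notMem (by simp), card_Iio_rank_image] at this
  exact_mod_cast this

/-- The level of the agent does not matter: whether or not `p` exceeds it, the agent's column within
the lowest remaining level has the smallest key. -/
theorem bestItem_columnProfile {C d p : ℕ} {S : Finset (Fin n)} {a i : Fin n}
    (hS : ∀ j ∈ S, p ≤ (j : ℕ) / (d * C)) (hi : i ∈ S) (hip : (i : ℕ) / (d * C) = p)
    (hcol : (i : ℕ) % C = a % C) :
    ((bestItem (columnProfile n C d) a S : Fin n) : ℕ) % C = a % C ∧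
      ((bestItem (columnProfile n C d) a S : Fin n) : ℕ) / (d * C) = p := by
  have h1 := hS _ (bestItem_mem (columnProfile n C d) a ⟨i, hi⟩)
  have h2 := columnKey_le_of_rank_le (rank_bestItem_le (columnProfile n C d) a hi)
  generalize bestItem (columnProfile n C d) a S = b at h1 h2
  have h3 := level_le C d i
  simp only [columnKey, hip, hcol, true_and, if_true] at h2 h3
  by_cases hb : (b : ℕ) % C = a % C
  · refine ⟨hb, ?_⟩
    simp only [hb, true_and, if_true] at h2
    split_ifs at h2 <;> omega
  · simp only [hb, false_and, if_false] at h2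
    split_ifs at h2 <;> omega

theorem card_cell_le {C d : ℕ} (hd : 0 < d) (c p : ℕ) :
    (Finset.univ.filter fun i : Fin n =>
      (i : ℕ) % C = c ∧ (i : ℕ) / (d * C) = p).card ≤ d := by
  conv_rhs => rw [← Finset.card_range d]
  refine Finset.card_le_card_of_injOn (fun i => (i : ℕ) / C % d) (fun i _ => ?_) ?_
  · exact Finset.mem_coe.2 (Finset.mem_range.2 (Nat.mod_lt _ hd))
  · intro i hi j hj h
    simp only [Finset.coe_filter, Finset.mem_univ, true_and, Set.mem_ofPred_eq] at hi hj h
    rw [mul_comm, ← Nat.div_div_eq_div_mul] at hi hj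
    have h1 : (i : ℕ) / C = j / C := by
      rw [← Nat.div_add_mod ((i : ℕ) / C) d, ← Nat.div_add_mod ((j : ℕ) / C) d, hi.2, hj.2, h]
    refine Fin.ext ?_
    rw [← Nat.div_add_mod (i : ℕ) C, ← Nat.div_add_mod (j : ℕ) C, h1, hi.1, hj.1]

/-- In each of the time windows of length `w`, at least `d` agents of each column arrive. -/
def EnoughArrivals (C d w : ℕ) (σ : Equiv.Perm (Fin n)) : Prop :=
  ∀ p c, (p + 1) * w ≤ n → c < C → d ≤ (Finset.univ.filter fun a : Fin n =>
    (a : ℕ) % C = c ∧ p * w ≤ (σ.symm a : ℕ) ∧ (σ.symm a : ℕ) < (p + 1) * w).card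

/-- By induction on windows. If an item of level `p` survived window `p`, every agent of its column
arriving in that window would have taken another item of the same cell; but at least `d` such agents
arrive and at most `d - 1` other items exist. -/
theorem le_level_of_mem_available {C d w : ℕ} (hC : 0 < C) (hd : 0 < d)
    {σ : Equiv.Perm (Fin n)} (hσ : EnoughArrivals C d w σ) {p : ℕ} (hp : p * w ≤ n) :
    ∀ i ∈ available (columnProfile n C d) σ (p * w), p ≤ (i : ℕ) / (d * C) := by
  induction p with
  | zero => simp
  | succ p ih =>
    have hw : p * w ≤ (p + 1) * w := Nat.mul_le_mul_right _ (by omega)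
    have ih := ih (by omega)
    intro i hi
    have hi' := available_antitone _ σ hw hi
    refine lt_of_le_of_ne (ih i hi') fun hip => ?_
    set A := Finset.univ.filter fun a : Fin n => (a : ℕ) % C = (i : ℕ) % C ∧
      p * w ≤ (σ.symm a : ℕ) ∧ (σ.symm a : ℕ) < (p + 1) * w with hA
    have hA1 : d ≤ A.card := hσ p _ hp (Nat.mod_lt _ hC)
    set cell := Finset.univ.filter fun j : Fin n =>
      (j : ℕ) % C = (i : ℕ) % C ∧ (j : ℕ) / (d * C) = p with hcell
    have hmem : i ∈ cell := by simp [hcell, ← hip]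
    have hA2 : A.card ≤ (cell.erase i).card := by
      refine Finset.card_le_card_of_injOn
        (fun a => pick (columnProfile n C d) σ (σ.symm a)) (fun a ha => ?_)
        fun a _ b _ h => σ.symm.injective (pick_injective _ σ h)
      obtain ⟨h1, h2, h3⟩ := (Finset.mem_filter.1 (Finset.mem_coe.1 ha)).2
      have h4 := available_antitone (columnProfile n C d) σ h3.le hi
      have h5 := bestItem_columnProfile (a := a)
        (fun j hj => ih j (available_antitone (columnProfile n C d) σ h2 hj)) h4 hip.symm h1.symm
      refine Finset.mem_coe.2 (Finset.mem_erase.2 ⟨?_, ?_⟩)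
      · intro h6
        refine pick_notMem (columnProfile n C d) σ h3 ?_
        change pick _ σ _ = i at h6
        rwa [h6]
      · refine Finset.mem_filter.2 ⟨Finset.mem_univ _, ?_⟩
        rw [← h1]
        simpa [pick] using h5
    have h7 : cell.card ≤ d := card_cell_le hd _ _
    rw [Finset.card_erase_of_mem hmem] at hA2
    have := Finset.card_pos.2 ⟨i, hmem⟩
    omega

theorem card_level_lt {m B : ℕ} (hB : 0 < B) (h : m * B ≤ n) :
    (Finset.univ.filter fun i : Fin n => (i : ℕ) / B < m).card = m * B := by
  simp_rw [Nat.div_lt_iff_lt_mul hB]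
  rw [Fin.card_filter_val_lt]
  exact min_eq_right h

/-- An agent all of whose own items are gone is left with an item of the first level that is not
yet exhausted, and prefers all items of the earlier levels. -/
theorem level_mul_le_rank_pick {C d w : ℕ} (hC : 0 < C) (hd : 0 < d) (hw : d * C ≤ w)
    {σ : Equiv.Perm (Fin n)} (hσ : EnoughArrivals C d w σ) {t : Fin n}
    (ht : (σ t : ℕ) / (d * C) < t / w) :
    (t : ℕ) / w * (d * C) ≤
      rank (columnProfile n C d) (σ t) (pick (columnProfile n C d) σ t) := by
  have h1 : (t : ℕ) / w * w ≤ t := Nat.div_mul_le_self _ _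
  have h2 : (t : ℕ) / w * (d * C) ≤ t := (Nat.mul_le_mul_left _ hw).trans h1
  have h3 := le_level_of_mem_available hC hd hσ (h1.trans t.2.le) _
    (available_antitone (columnProfile n C d) σ h1 (pick_mem _ σ t))
  rw [← card_level_lt (n := n) (mul_pos hd hC) (h2.trans t.2.le), ← card_Iio_rank_image]
  refine Finset.card_le_card fun i hi => Finset.mem_filter.2 ⟨Finset.mem_univ _, ?_⟩
  have hi := (Finset.mem_filter.1 hi).2
  by_contra hlt
  have h4 := columnKey_le_of_rank_le (not_lt.1 hlt)
  generalize pick (columnProfile n C d) σ t = b at *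
  have h5 := level_le C d i
  simp only [columnKey] at h4
  split_ifs at h4 <;> omega

/-! ### Exceptional orders and the total rank -/

theorem card_window {p w : ℕ} (h : (p + 1) * w ≤ n) :
    (Finset.univ.filter fun x : Fin n => p * w ≤ (x : ℕ) ∧ (x : ℕ) < (p + 1) * w).card = w := by
  have h1 : (Finset.Ico (p * w) ((p + 1) * w)).card = w := by
    rw [Nat.card_Ico, ← Nat.sub_mul]
    simp
  conv_rhs => rw [← h1]
  refine Finset.card_bij (fun x _ => (x : ℕ)) ?_ (fun x _ y _ h => Fin.ext h) ?_
  · intro x hx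
    exact Finset.mem_Ico.2 (Finset.mem_filter.1 hx).2
  · intro b hb
    have hb := Finset.mem_Ico.1 hb
    exact ⟨⟨b, by omega⟩, by simpa using hb, rfl⟩

open scoped Classical in
theorem card_not_enoughArrivals_le {C d w : ℕ} (hn : 0 < n) (hw : 0 < w) (hC : 0 < C) {η : ℝ}
    (hη : 0 < η) (h : (1 + η) ^ 2 * d * n ≤ w * (n / C : ℕ)) :
    ((Finset.univ.filter fun σ : Equiv.Perm (Fin n) => ¬ EnoughArrivals C d w σ).card : ℝ) ≤
      n * C * (n.factorial * Real.exp (-(η ^ 2 * d))) := by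
  set I := (Finset.range n ×ˢ Finset.range C).filter fun x : ℕ × ℕ => (x.1 + 1) * w ≤ n with hI
  set F : ℕ × ℕ → Finset (Equiv.Perm (Fin n)) := fun x =>
    Finset.univ.filter fun σ : Equiv.Perm (Fin n) => (Finset.univ.filter fun a : Fin n =>
      (a : ℕ) % C = x.2 ∧ x.1 * w ≤ (σ.symm a : ℕ) ∧ (σ.symm a : ℕ) < (x.1 + 1) * w).card < d
    with hF
  have hsub : (Finset.univ.filter fun σ : Equiv.Perm (Fin n) => ¬ EnoughArrivals C d w σ) ⊆
      I.biUnion F := by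
    intro σ hσ
    have hσ := (Finset.mem_filter.1 hσ).2
    simp only [EnoughArrivals, not_forall, not_le] at hσ
    obtain ⟨p, c, hp, hc, hlt⟩ := hσ
    refine Finset.mem_biUnion.2 ⟨(p, c), ?_, Finset.mem_filter.2 ⟨Finset.mem_univ _, hlt⟩⟩
    refine Finset.mem_filter.2 ⟨Finset.mem_product.2 ⟨Finset.mem_range.2 ?_,
      Finset.mem_range.2 hc⟩, hp⟩
    exact lt_of_lt_of_le (Nat.lt_succ_self p) ((Nat.le_mul_of_pos_right _ hw).trans hp)
  have hFle : ∀ x ∈ I, ((F x).card : ℝ) ≤ n.factorial * Real.exp (-(η ^ 2 * d)) := by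
    rintro ⟨p, c⟩ hx
    obtain ⟨hx, hp⟩ := Finset.mem_filter.1 hx
    have hc : c < C := Finset.mem_range.1 (Finset.mem_product.1 hx).2
    set W := Finset.univ.filter fun x : Fin n => p * w ≤ (x : ℕ) ∧ (x : ℕ) < (p + 1) * w with hW
    set A := Finset.univ.filter fun i : Fin n => (i : ℕ) % C = c % C with hA
    have hAcard : n / C ≤ A.card := by rw [hA, card_column n hC]; omega
    have key := card_perm_few_le hn W A (d := d) hη (h.trans (by
      rw [card_window hp]
      gcongr))
    refine le_trans (Nat.cast_le.2 ?_) key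
    -- Arrival orders send times to agents, whereas the Chernoff bound concerns agents sent to
    -- times.
    refine Finset.card_le_card_of_injOn (fun σ => σ⁻¹) (fun σ hσ => ?_)
      fun _ _ _ _ h => inv_injective h
    have hσ := (Finset.mem_filter.1 (Finset.mem_coe.1 hσ)).2
    refine Finset.mem_coe.2 (Finset.mem_filter.2 ⟨Finset.mem_univ _, ?_⟩)
    convert hσ using 2
    ext a
    simp [hA, hW, Nat.mod_eq_of_lt hc, Equiv.Perm.inv_def]
  have hIcard : I.card ≤ n * C := (Finset.card_filter_le _ _).trans (by simp)
  calc _ ≤ (((I.biUnion F).card : ℕ) : ℝ) := Nat.cast_le.2 (Finset.card_le_card hsub)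
    _ ≤ ((∑ x ∈ I, (F x).card : ℕ) : ℝ) := Nat.cast_le.2 Finset.card_biUnion_le
    _ = ∑ x ∈ I, ((F x).card : ℝ) := by push_cast; rfl
    _ ≤ ∑ x ∈ I, (n.factorial * Real.exp (-(η ^ 2 * d))) := Finset.sum_le_sum hFle
    _ = I.card * (n.factorial * Real.exp (-(η ^ 2 * d))) := by simp
    _ ≤ _ := by
      gcongr
      exact_mod_cast hIcard

open scoped Classical in
theorem le_totalRank_columnProfile {C d w : ℕ} (hC : 0 < C) (hd : 0 < d) (hw : d * C ≤ w) :
    n.factorial * ∑ t : Fin n, ((t : ℕ) / w * (d * C)) ^ 2 ≤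
      n * totalRank (columnProfile n C d) + n ^ 3 *
        (Finset.univ.filter fun σ : Equiv.Perm (Fin n) => ¬ EnoughArrivals C d w σ).card := by
  set bad := Finset.univ.filter fun σ : Equiv.Perm (Fin n) => ¬ EnoughArrivals C d w σ with hbad
  have hB : 0 < d * C := mul_pos hd hC
  have key : ∀ t : Fin n, n.factorial * ((t : ℕ) / w * (d * C)) ^ 2 ≤
      n * ∑ σ : Equiv.Perm (Fin n),
        (rank (columnProfile n C d) (σ t) (pick (columnProfile n C d) σ t) : ℕ) +
      n ^ 2 * bad.card := by
    intro t
    set L := (t : ℕ) / w * (d * C) with hL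
    have hLn : L ≤ n := ((Nat.mul_le_mul_left _ hw).trans (Nat.div_mul_le_self _ _)).trans t.2.le
    -- The agent at time `t` is uniform, so its level is below `t / w` with probability `L / n`; its
    -- rank is then at least `L` on good orders, whence the square.
    have h1 := card_mul_sum_perm_apply
      (fun a : Fin n => if (a : ℕ) / (d * C) < t / w then 1 else 0) t
    rw [← Finset.card_filter, ← Finset.card_filter, card_level_lt hB hLn, ← hL] at h1
    set G := Finset.univ.filter fun σ : Equiv.Perm (Fin n) => (σ t : ℕ) / (d * C) < t / w
    have h2 : G.card * L ≤ ∑ σ : Equiv.Perm (Fin n),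
        (rank (columnProfile n C d) (σ t) (pick (columnProfile n C d) σ t) : ℕ) +
        bad.card * L := by
      calc G.card * L = ∑ σ : Equiv.Perm (Fin n),
            if (σ t : ℕ) / (d * C) < t / w then L else 0 := by
            rw [← Finset.sum_filter]; simp [G]
        _ ≤ ∑ σ : Equiv.Perm (Fin n),
            ((rank (columnProfile n C d) (σ t) (pick (columnProfile n C d) σ t) : ℕ) +
            if ¬ EnoughArrivals C d w σ then L else 0) := by
            refine Finset.sum_le_sum fun σ _ => ?_
            by_cases h3 : (σ t : ℕ) / (d * C) < t / w
            · by_cases h4 : EnoughArrivals C d w σ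
              · rw [if_pos h3]
                exact (level_mul_le_rank_pick hC hd hw h4 h3).trans (Nat.le_add_right _ _)
              · rw [if_pos h3, if_pos h4]
                exact Nat.le_add_left _ _
            · rw [if_neg h3]
              exact Nat.zero_le _
        _ = _ := by
            rw [Finset.sum_add_distrib, ← Finset.sum_filter]; simp [hbad]
    calc n.factorial * L ^ 2 = n * (G.card * L) := by rw [sq, ← mul_assoc, ← h1]; ring
      _ ≤ _ := Nat.mul_le_mul_left n h2
      _ ≤ _ := by
        rw [mul_add]
        refine Nat.add_le_add_left ?_ _
        calc n * (bad.card * L) ≤ n * (bad.card * n) := by gcongr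
          _ = _ := by ring
  rw [Finset.mul_sum]
  refine (Finset.sum_le_sum fun t _ => key t).trans (le_of_eq ?_)
  rw [Finset.sum_add_distrib, ← Finset.mul_sum, totalRank]
  simp
  ring

/-! ### Estimates and choice of parameters -/

theorem le_sum_fin_sq (n : ℕ) :
    (n : ℝ) ^ 3 / 3 - n ^ 2 / 2 ≤ ∑ t : Fin n, ((t : ℕ) : ℝ) ^ 2 := by
  rw [Fin.sum_univ_eq_sum_range (fun t : ℕ => (t : ℝ) ^ 2)]
  induction n with
  | zero => simp
  | succ n ih =>
    rw [Finset.sum_range_succ]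
    push_cast
    nlinarith

/-- Rounding `t` down to a whole window costs at most one level `B`, and the window exceeds a level
by a factor of at most `ρ`; each term is thus at least `(t / ρ) ^ 2 - 2 * n * B`. -/
theorem le_sum_level_sq {B w : ℕ} {ρ : ℝ} (hρ : 1 ≤ ρ) (hw0 : 0 < w) (hw : (w : ℝ) ≤ ρ * B) :
    (n : ℝ) ^ 2 * (n / (3 * ρ ^ 2) - 1 / 2 - 2 * B) ≤
      ∑ t : Fin n, (((t : ℕ) / w : ℕ) * B : ℝ) ^ 2 := by
  have hρ0 : 0 < ρ := by linarith
  have hB : (0 : ℝ) ≤ B := by positivity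
  have hterm : ∀ t : Fin n, ((t : ℕ) : ℝ) ^ 2 / ρ ^ 2 - 2 * n * B ≤
      (((t : ℕ) / w : ℕ) * B : ℝ) ^ 2 := by
    intro t
    set x : ℝ := ((t : ℕ) / w : ℕ) * B with hx
    have hx0 : 0 ≤ x := by positivity
    have h1 : ((t : ℕ) : ℝ) ≤ (((t : ℕ) / w : ℕ) + 1) * w := by
      have := Nat.lt_mul_div_succ (t : ℕ) hw0
      have h2 : (t : ℕ) ≤ ((t : ℕ) / w + 1) * w := by rw [mul_comm]; exact this.le
      exact_mod_cast h2
    have h2 : ((t : ℕ) : ℝ) ≤ (x + B) * ρ := by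
      refine h1.trans ((mul_le_mul_of_nonneg_left hw (by positivity)).trans (le_of_eq ?_))
      rw [hx]; ring
    have h3 : ((t : ℕ) : ℝ) / ρ ≤ x + B := (div_le_iff₀ hρ0).2 h2
    have h4 : ((t : ℕ) : ℝ) / ρ ≤ n :=
      (div_le_self (by positivity) hρ).trans (by exact_mod_cast t.2.le)
    have h5 : 0 ≤ ((t : ℕ) : ℝ) / ρ := by positivity
    rw [← div_pow]
    generalize ((t : ℕ) : ℝ) / ρ = y at *
    rcases le_total y B with h6 | h6
    · nlinarith [mul_nonneg h5 hB, mul_le_mul_of_nonneg_right h4 hB, sq_nonneg x]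
    · nlinarith [mul_le_mul_of_nonneg_right h4 hB, sq_nonneg B]
  refine le_trans ?_ (Finset.sum_le_sum fun t _ => hterm t)
  rw [Finset.sum_sub_distrib, ← Finset.sum_div]
  have h1 : ((n : ℝ) ^ 3 / 3 - n ^ 2 / 2) / ρ ^ 2 ≤ (∑ t : Fin n, ((t : ℕ) : ℝ) ^ 2) / ρ ^ 2 :=
    div_le_div_of_nonneg_right (le_sum_fin_sq n) (by positivity)
  have h2 : (n : ℝ) ^ 2 / 2 / ρ ^ 2 ≤ n ^ 2 / 2 := div_le_self (by positivity) (by nlinarith)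
  have h3 : (n : ℝ) ^ 2 * (n / (3 * ρ ^ 2)) = n ^ 3 / 3 / ρ ^ 2 := by field_simp
  rw [sub_div] at h1
  simp only [Finset.sum_const, Finset.card_univ, Fintype.card_fin, nsmul_eq_mul]
  nlinarith

theorem one_sub_mul_le_inv_one_add_pow {η : ℝ} (hη : 0 ≤ η) : 1 - 6 * η ≤ ((1 + η) ^ 6)⁻¹ := by
  rw [← inv_pow]
  have h : -1 ≤ (1 + η)⁻¹ - 1 := by
    have : 0 ≤ (1 + η)⁻¹ := by positivity
    linarith
  have h1 := one_add_mul_le_pow (a := (1 + η)⁻¹ - 1) (by linarith) 6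
  have h2 : (1 + η)⁻¹ - 1 = -(η / (1 + η)) := by field_simp; ring
  have h3 : η / (1 + η) ≤ η := div_le_self hη (by linarith)
  rw [add_sub_cancel] at h1
  push_cast at h1
  linarith

theorem rsdWelfare_columnProfile_le {C d w : ℕ} (hn : 0 < n) (hC : 0 < C) (hd : 0 < d)
    (hw : d * C ≤ w) {η : ℝ} (hη : 0 < η) (hw' : (w : ℝ) ≤ (1 + η) ^ 3 * (d * C : ℕ))
    (h : (1 + η) ^ 2 * d * n ≤ w * (n / C : ℕ)) :
    rsdWelfare (columnProfile n C d) ≤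
      n * (2 / 3 + 2 * η + n * C * Real.exp (-(η ^ 2 * d))) + 1 / 2 + 2 * (d * C : ℕ) := by
  classical
  have hw0 : 0 < w := (mul_pos hd hC).trans_le hw
  have hn' : (0 : ℝ) < n := by exact_mod_cast hn
  have hf : (0 : ℝ) < n.factorial := by positivity
  have h1 := card_not_enoughArrivals_le hn hw0 hC hη h
  have h2 := (Nat.cast_le (α := ℝ)).2 (le_totalRank_columnProfile (n := n) hC hd hw)
  have h3 := le_sum_level_sq (n := n) (one_le_pow₀ (by linarith : 1 ≤ 1 + η)) hw0 hw'
  have h4 := one_sub_mul_le_inv_one_add_pow hη.le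
  rw [rsdWelfare_eq]
  generalize (d * C : ℕ) = B at *
  generalize columnProfile n C d = P at *
  set E := Real.exp (-(η ^ 2 * d))
  push_cast at h2
  set S := ∑ t : Fin n, (((t : ℕ) / w : ℕ) * B : ℝ) ^ 2
  have h5 : (n.factorial : ℝ) * (n ^ 2 * (n / (3 * ((1 + η) ^ 3) ^ 2) - 1 / 2 - 2 * B)) ≤
      n * totalRank P + n ^ 3 * (n * C * (n.factorial * E)) :=
    (mul_le_mul_of_nonneg_left h3 hf.le).trans
      (h2.trans (by gcongr))
  have h6 : n / (3 * ((1 + η) ^ 3) ^ 2) - 1 / 2 - 2 * B - n * n * C * E ≤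
      (totalRank P : ℝ) / (n * n.factorial) := by
    rw [le_div_iff₀ (by positivity)]
    refine le_of_mul_le_mul_left ?_ hn'
    nlinarith
  have h7 : (n : ℝ) / (3 * ((1 + η) ^ 3) ^ 2) = n / 3 * ((1 + η) ^ 6)⁻¹ := by
    rw [← pow_mul]; field_simp
  have h8 : (n : ℝ) / 3 * (1 - 6 * η) ≤ n / 3 * ((1 + η) ^ 6)⁻¹ :=
    mul_le_mul_of_nonneg_left h4 (by positivity)
  rw [h7] at h6
  linarith

theorem sub_le_optWelfare (P : Profile n) {k : ℝ} (hk : IsEfficient P k) (hn : 0 < n) :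
    n - k ≤ optWelfare P := by
  obtain ⟨M, hM⟩ := hk
  refine le_trans ?_ (welfare_le_optWelfare P M)
  have hn' : (0 : ℝ) < n := by exact_mod_cast hn
  calc (n : ℝ) - k = ∑ a : Fin n, (1 - k / n) := by simp; field_simp
    _ ≤ _ := Finset.sum_le_sum fun a _ => by
      unfold utility
      have := hM a
      gcongr
      linarith

/-- The instance with about `n / s ^ 2` columns and with levels of about `n / s` items. -/
theorem exists_efficient_of_pow_le {s : ℕ} {η : ℝ} (hη : 0 < η) (hη1 : η ≤ 1) (hs4 : 4 ≤ s)
    (hsη : 2 ≤ η * s) (h1 : s ^ 10 ≤ n) (h2 : n ≤ (s + 1) ^ 10)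
    (herr : 5 / s + ((s : ℝ) + 1) ^ 20 * Real.exp (-(η ^ 2 * s)) ≤ η) :
    ∃ P : Profile n, IsEfficient P ((s : ℝ) ^ 2) ∧ rsdWelfare P ≤ n * (2 / 3 + 3 * η) ∧
      n * (1 - η) ≤ optWelfare P := by
  have hs0 : 0 < s := by omega
  have hn : 0 < n := (pow_pos hs0 10).trans_le h1
  set C := n / s ^ 2 + 1 with hC
  have hC0 : 0 < C := Nat.succ_pos _
  -- The Chernoff bound needs two factors `1 + η`; the third absorbs the rounding in `w` and `n /
  -- C`, using `2 ≤ η * s`.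
  set w := ⌊(1 + η) ^ 3 * (s * C : ℕ)⌋₊ with hw
  have hsR : (4 : ℝ) ≤ s := by exact_mod_cast hs4
  have hsR0 : (0 : ℝ) < s := by linarith
  have hnR : (0 : ℝ) < n := by exact_mod_cast hn
  have hn1 : (1 : ℝ) ≤ n := by exact_mod_cast hn
  have hs3n : (s : ℝ) ^ 3 ≤ n := by
    exact_mod_cast (Nat.pow_le_pow_right hs0 (by norm_num)).trans h1
  have hs2n : (s : ℝ) ^ 2 ≤ n := le_trans (pow_le_pow_right₀ (by linarith) (by norm_num)) hs3n
  have hnC : n ≤ s ^ 2 * C := by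
    have := Nat.lt_mul_div_succ n (pow_pos hs0 2)
    rw [hC]; exact this.le
  have hCn : C ≤ n := by
    have : n / s ^ 2 < n := Nat.div_lt_self hn (Nat.one_lt_pow (by norm_num) (by omega))
    omega
  have hCnR : (C : ℝ) ≤ n := by exact_mod_cast hCn
  have hCR0 : (0 : ℝ) < C := by exact_mod_cast hC0
  have hnCR : (n : ℝ) / C ≤ s ^ 2 := by
    rw [div_le_iff₀ hCR0]; exact_mod_cast hnC
  have hCle : (C : ℝ) ≤ n / s ^ 2 + 1 := by
    have := Nat.cast_div_le (α := ℝ) (m := n) (n := s ^ 2)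
    rw [hC]; push_cast at this ⊢; linarith
  have hsC : (s : ℝ) * C ≤ n / s + s := by
    calc (s : ℝ) * C ≤ s * (n / s ^ 2 + 1) := mul_le_mul_of_nonneg_left hCle hsR0.le
      _ = _ := by field_simp
  have hsn : (s : ℝ) ≤ n / s := by rw [le_div_iff₀ hsR0, ← sq]; exact hs2n
  have hη3 : 1 ≤ (1 + η) ^ 3 := one_le_pow₀ (by linarith)
  have hBw : s * C ≤ w := Nat.le_floor (le_mul_of_one_le_left (by positivity) hη3)
  have hwle : (w : ℝ) ≤ (1 + η) ^ 3 * (s * C : ℕ) := Nat.floor_le (by positivity)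
  have hcond : (1 + η) ^ 2 * s * n ≤ w * (n / C : ℕ) := by
    have hw1 : (1 + η) ^ 3 * (s * C) - 1 ≤ (w : ℝ) := by
      have := Nat.lt_floor_add_one ((1 + η) ^ 3 * ((s * C : ℕ) : ℝ))
      rw [← hw] at this
      push_cast at this
      linarith
    have hdiv : (n : ℝ) / C - 1 ≤ (n / C : ℕ) := by
      have := Nat.lt_div_mul_add (a := n) hC0
      have h3 : (n : ℝ) < (n / C : ℕ) * C + C := by exact_mod_cast this
      rw [sub_le_iff_le_add, div_le_iff₀ hCR0]
      linarith
    have hdiv0 : 0 ≤ (n : ℝ) / C - 1 := by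
      rw [sub_nonneg, le_div_iff₀ hCR0]; linarith
    have hkey : (1 + η) ^ 2 * s * n ≤ ((1 + η) ^ 3 * (s * C) - 1) * (n / C - 1) := by
      have e1 : ((1 + η) ^ 3 * (s * C) - 1) * ((n : ℝ) / C - 1) =
          (1 + η) ^ 3 * s * n - n / C - (1 + η) ^ 3 * (s * C) + 1 := by field_simp; ring
      have e2 : (n : ℝ) / C ≤ n := hnCR.trans hs2n
      have e3 : (s : ℝ) * C ≤ 2 * n / 4 := by
        have : (n : ℝ) / s ≤ n / 4 := div_le_div_of_nonneg_left hnR.le (by norm_num) hsR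
        linarith
      have e4 : (1 + η) ^ 3 * (s * C) ≤ (1 + η) ^ 2 * n := by
        have : (1 + η) * (s * C) ≤ n := by
          have : (1 + η) * (s * C) ≤ 2 * (2 * n / 4) :=
            mul_le_mul (by linarith) e3 (by positivity) (by norm_num)
          linarith
        calc (1 + η) ^ 3 * (s * C) = (1 + η) ^ 2 * ((1 + η) * (s * C)) := by ring
          _ ≤ _ := mul_le_mul_of_nonneg_left this (by positivity)
      have e5 : (n : ℝ) ≤ (1 + η) ^ 2 * n :=
        le_mul_of_one_le_left hnR.le (one_le_pow₀ (by linarith))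
      have e6 : (1 + η) ^ 2 * n * 2 ≤ (1 + η) ^ 2 * n * (η * s) :=
        mul_le_mul_of_nonneg_left hsη (by positivity)
      rw [e1]
      nlinarith
    exact hkey.trans (mul_le_mul hw1 hdiv hdiv0 (by positivity))
  have heff : IsEfficient (columnProfile n C s) ((s ^ 2 : ℕ) : ℝ) :=
    columnProfile_isEfficient hC0 hnC
  push_cast at heff
  have hexp : (n : ℝ) * C ≤ (s + 1) ^ 20 := by
    have h3 : (n : ℝ) ≤ (s + 1) ^ 10 := by exact_mod_cast h2
    calc (n : ℝ) * C ≤ (s + 1) ^ 10 * (s + 1) ^ 10 :=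
          mul_le_mul h3 (hCnR.trans h3) hCR0.le (by positivity)
      _ = _ := by ring
  have h5 : 5 / (s : ℝ) ≤ η := le_trans (le_add_of_nonneg_right (by positivity)) herr
  refine ⟨columnProfile n C s, heff, ?_, ?_⟩
  · refine (rsdWelfare_columnProfile_le hn hC0 hs0 hBw hη hwle hcond).trans ?_
    have h6 : (n : ℝ) * C * Real.exp (-(η ^ 2 * s)) ≤
        (s + 1) ^ 20 * Real.exp (-(η ^ 2 * s)) := by gcongr
    have h7 : (n : ℝ) * (2 / 3 + 2 * η + n * C * Real.exp (-(η ^ 2 * s))) ≤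
        n * (2 / 3 + 2 * η + (η - 5 / s)) := by
      refine mul_le_mul_of_nonneg_left ?_ hnR.le
      linarith
    have h8 : (n : ℝ) * (5 / s) = 5 * (n / s) := by ring
    push_cast
    linarith
  · refine le_trans ?_ (sub_le_optWelfare _ heff hn)
    have h6 : 1 / (s : ℝ) ≤ η := le_trans (by gcongr; norm_num) h5
    have h7 : (s : ℝ) ^ 2 ≤ n * (1 / s) := by
      rw [mul_one_div, le_div_iff₀ hsR0]
      linarith [pow_succ (s : ℝ) 2]
    have h8 : (n : ℝ) * (1 / s) ≤ n * η := mul_le_mul_of_nonneg_left h6 hnR.le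
    linarith

theorem tendsto_error {η : ℝ} (hη : 0 < η) :
    Tendsto (fun s : ℕ => 5 / (s : ℝ) + ((s : ℝ) + 1) ^ 20 * Real.exp (-(η ^ 2 * s)))
      atTop (𝓝 0) := by
  have h1 : Tendsto (fun s : ℕ => 5 / (s : ℝ)) atTop (𝓝 0) :=
    tendsto_const_div_atTop_nhds_zero_nat 5
  have h2 : Tendsto (fun x : ℝ => x ^ (20 : ℝ) * Real.exp (-(η ^ 2) * x)) atTop (𝓝 0) :=
    tendsto_rpow_mul_exp_neg_mul_atTop_nhds_zero 20 (η ^ 2) (by positivity)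
  have h3 : Tendsto (fun s : ℕ => (s : ℝ) + 1) atTop atTop :=
    tendsto_atTop_add_const_right _ _ tendsto_natCast_atTop_atTop
  have h4 := (h2.comp h3).mul_const (Real.exp (η ^ 2))
  rw [zero_mul] at h4
  have h5 := h1.add h4
  rw [zero_add] at h5
  refine h5.congr fun s => ?_
  simp only [Function.comp]
  rw [mul_assoc, ← Real.exp_add]
  congr 2
  · norm_cast
  · congr 1; ring

theorem IsEfficient.mono {P : Profile n} {k l : ℝ} (h : IsEfficient P k) (hkl : k ≤ l) :
    IsEfficient P l := by
  obtain ⟨M, hM⟩ := h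
  exact ⟨M, fun a => (hM a).trans hkl⟩

theorem eventually_exists_efficient {δ : ℝ} (hδ : 0 < δ) :
    ∀ᶠ n : ℕ in atTop, ∃ P : Profile n, IsEfficient P ((n : ℝ) ^ ((1 : ℝ) / 5)) ∧
      rsdWelfare P ≤ (2 / 3 + δ) * optWelfare P := by
  set η := min (δ / 8) (1 / 8) with hη
  have hη0 : 0 < η := by positivity
  have hη1 : η ≤ 1 / 8 := min_le_right _ _
  have hηδ : 8 * η ≤ δ := by
    have : η ≤ δ / 8 := min_le_left _ _
    linarith
  -- With `s` near `n ^ (1 / 10)`, columns have at most `s ^ 2 ≤ n ^ (1 / 5)` items, and cells of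
  -- size `s` make the exponential beat the polynomial union bound.
  have hs : Tendsto (fun n : ℕ => ⌊(n : ℝ) ^ ((1 : ℝ) / 10)⌋₊) atTop atTop :=
    tendsto_nat_floor_atTop.comp
      ((tendsto_rpow_atTop (by norm_num)).comp tendsto_natCast_atTop_atTop)
  have hgood : ∀ᶠ s : ℕ in atTop, 4 ≤ s ∧ 2 ≤ η * s ∧
      5 / (s : ℝ) + ((s : ℝ) + 1) ^ 20 * Real.exp (-(η ^ 2 * s)) ≤ η := by
    refine (eventually_ge_atTop 4).and (Filter.Eventually.and ?_ ?_)
    · exact (tendsto_natCast_atTop_atTop.const_mul_atTop hη0).eventually_ge_atTop 2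
    · exact (tendsto_error hη0).eventually_le_const hη0
  filter_upwards [hs.eventually hgood] with n hn
  obtain ⟨hs4, hsη, herr⟩ := hn
  set x := (n : ℝ) ^ ((1 : ℝ) / 10) with hx
  have hx0 : 0 ≤ x := by positivity
  have hx10 : x ^ 10 = n := by
    rw [hx, ← Real.rpow_natCast, ← Real.rpow_mul (by positivity)]
    norm_num
  have hx2 : x ^ 2 = (n : ℝ) ^ ((1 : ℝ) / 5) := by
    rw [hx, ← Real.rpow_natCast, ← Real.rpow_mul (by positivity)]
    norm_num
  have hsx : (⌊x⌋₊ : ℝ) ≤ x := Nat.floor_le hx0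
  have hxs : x ≤ ⌊x⌋₊ + 1 := (Nat.lt_floor_add_one x).le
  obtain ⟨P, hP, hrsd, hopt⟩ := exists_efficient_of_pow_le (n := n) hη0 (by linarith) hs4 hsη
    (by
      have := pow_le_pow_left₀ (by positivity) hsx 10
      rw [hx10] at this
      exact_mod_cast this)
    (by
      have := pow_le_pow_left₀ hx0 hxs 10
      rw [hx10] at this
      exact_mod_cast this) herr
  refine ⟨P, IsEfficient.mono hP ?_, hrsd.trans ?_⟩
  · rw [← hx2]
    exact pow_le_pow_left₀ (by positivity) hsx 2
  · calc (n : ℝ) * (2 / 3 + 3 * η) ≤ (2 / 3 + 8 * η) * (n * (1 - η)) := by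
          rw [mul_left_comm]
          refine mul_le_mul_of_nonneg_left ?_ (by positivity)
          nlinarith
      _ ≤ (2 / 3 + δ) * optWelfare P :=
          mul_le_mul (by linarith) hopt (mul_nonneg (by positivity) (by linarith)) (by linarith)

theorem exists_isEfficient (n : ℕ) :
    ∃ P : Profile n, IsEfficient P ((n : ℝ) ^ ((1 : ℝ) / 5)) := by
  rcases Nat.eq_zero_or_pos n with rfl | hn
  · exact ⟨1, 1, fun a => a.elim0⟩
  -- Each agent `a` ranks item `a` first.
  · refine ⟨fun a => Equiv.swap ⟨0, hn⟩ a, 1, fun a => ?_⟩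
    have h : (1 : ℝ) ≤ (n : ℝ) ^ ((1 : ℝ) / 5) :=
      Real.one_le_rpow (by exact_mod_cast hn) (by norm_num)
    simpa [rank] using h

/-- Among the `n ^ (1 / 5)`-efficient instances with `n` agents, one on which random serial
dictatorship performs worst. -/
theorem exists_worst (n : ℕ) : ∃ P : Profile n, IsEfficient P ((n : ℝ) ^ ((1 : ℝ) / 5)) ∧
    ∀ Q : Profile n, IsEfficient Q ((n : ℝ) ^ ((1 : ℝ) / 5)) →
      rsdWelfare P / optWelfare P ≤ rsdWelfare Q / optWelfare Q :=
  Set.exists_min_image {P : Profile n | IsEfficient P ((n : ℝ) ^ ((1 : ℝ) / 5))}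
    (fun P => rsdWelfare P / optWelfare P) (Set.toFinite _) (exists_isEfficient n)

end OneSidedMatching

theorem theorem3 :
    (∀ k : ℕ → ℝ, k =o[atTop] (fun n : ℕ => (n : ℝ)) →
      ∃ ε : ℕ → ℝ, Tendsto ε atTop (𝓝 0) ∧
        ∀ (n : ℕ) (P : OneSidedMatching.Profile n), OneSidedMatching.IsEfficient P (k n) →
          (2 / 3 - ε n) * OneSidedMatching.optWelfare P ≤ OneSidedMatching.rsdWelfare P) ∧
    (∃ ε : ℕ → ℝ, Tendsto ε atTop (𝓝 0) ∧
      ∀ n : ℕ, ∃ P : OneSidedMatching.Profile n,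
        OneSidedMatching.IsEfficient P ((n : ℝ) ^ ((1 : ℝ) / 5)) ∧
          OneSidedMatching.rsdWelfare P ≤
            (2 / 3 + ε n) * OneSidedMatching.optWelfare P) := by
  open OneSidedMatching in
  refine ⟨fun k hk => ⟨fun n => |k n| / n, ?_, fun n P hP =>
    mul_optWelfare_le_rsdWelfare P hP⟩, ?_⟩
  · have := hk.tendsto_div_nhds_zero.abs
    simpa [abs_div] using this
  · choose P hP hmin using exists_worst
    -- Taking a worst instance for each `n` turns "for every `δ`, eventually" into a single null
    -- sequence; the maximum with `0` makes its lower bound automatic.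
    refine ⟨fun n => max 0 (rsdWelfare (P n) / optWelfare (P n) - 2 / 3), ?_, fun n =>
      ⟨P n, hP n, ?_⟩⟩
    · refine tendsto_order.2 ⟨fun a ha => Eventually.of_forall fun n =>
        ha.trans_le (le_max_left _ _), fun δ hδ => ?_⟩
      filter_upwards [eventually_exists_efficient (half_pos hδ), eventually_gt_atTop 0]
        with n hn hn0
      obtain ⟨Q, hQ, hQle⟩ := hn
      have h1 := (hmin n Q hQ).trans ((div_le_iff₀ (optWelfare_pos Q hn0)).2 hQle)
      exact max_lt hδ (by linarith)
    · rcases Nat.eq_zero_or_pos n with rfl | hn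
      · simp [rsdWelfare_eq, le_antisymm (by simpa using optWelfare_le (P 0))
          (optWelfare_nonneg (P 0))]
      · rw [← div_le_iff₀ (optWelfare_pos _ hn)]
        linarith [le_max_right 0 (rsdWelfare (P n) / optWelfare (P n) - 2 / 3)]
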